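/- **Problem.** Consider a stagewise independent multistage stochastic program with stages $0,\dots,T$, written on its recombining scenario tree: stage $0$ consists of the root $r$, stage $t\ge 1$ has a finite set $\tilde{\mathcal N}(t)$ of nodes with distinct data, every node of stage $t<T$ has all $n\in\tilde{\mathcal N}(t+1)$ as children, reached with probability $p_n>0$, and $\sum_{n\in\tilde{\mathcal N}(t+1)}p_n=1$. A node $n$ has a compact set $\mathcal F_n$ of feasible pairs $(x,y)$ (state and internal variables, in finite-dimensional spaces) and a lower semicontinuous cost $f_n(z,y,x)\in[0,+\infty]$, where $z$ stands for the state of the parent. The root cost $f_r(y,x)$ has no argument $z$. The states of stage $t$ lie in $\mathbb R^{d_t}$, with a norm $\|\cdot\|$ and dual norm $\|\cdot\|_*$. For $t<T$ all nodes of stage $t$ have the same projection $\mathcal X_t\subseteq\mathbb R^{d_t}$ of $\mathcal F_n$ to the state variable. Feasible decisions with finite costs at all nodes of the scenario tree exist. For every non-root node $n$ of stage $t+1$ let $\psi_n:\mathbb R^{d_t}\to[0,\infty)$ be a penalty function ($\psi_n(x)=0$ iff $x=0$, and the diameter of $\{\psi_n\le a\}$ tends to $0$ as $a\downarrow0$)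 that is $1$-Lipschitz on $\mathcal X_t-\mathcal X_t$; let $\sigma_n>0$, $l_{n,\lambda},l_{n,\rho}\ge0$, and $\mathcal U_n=\{(\lambda,\rho):\|\lambda\|_*\le l_{n,\lambda},\ 0\le\rho\le l_{n,\rho}\}$. Assume that either the problem is convex (all $\mathcal F_n$, $f_n$, $\psi_n$ are convex), $\psi_n=\|\cdot\|$, $l_{n,\lambda}\ge\sigma_n$ and $l_{n,\rho}=0$ for all $n\ne r$; or $l_{n,\rho}\ge\sigma_n$ for all $n\neq r$. Put $L_t=\sum_{n\in\tilde{\mathcal N}(t+1)}p_n(l_{n,\lambda}+l_{n,\rho})$ for $t<T$. **Algorithm (deterministic sampling dual dynamic programming, tolerance $\epsilon>0$).** Initially $\underline{\mathcal Q}^0_t=0$ for all $t$, $\overline{\mathcal Q}^0_t=+\infty$ for $t<T$; moreover $\underline{\mathcal Q}^i_T=\overline{\mathcal Q}^i_T=0$ for all $i$. The root oracle returns a minimizer $(x_0^1,y_0^1)$ of $f_r$ over $\mathcal F_r$; put $\mathrm{LB}=f_r(y_0^1,x_0^1)$ and $\mathrm{UB}=+\infty$. While $\mathrm{UB}-\mathrm{LB}>\epsilon$,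 carry out iteration $i=1,2,\dots$: 1. *Forward step.* For $t=1,\dots,T$ and each $n\in\tilde{\mathcal N}(t)$ obtain a minimizer $(x_n^i,y_n^i,z_n^i)$ of $f_n(z,y,x)+\sigma_n\psi_n(x_{t-1}^i-z)+\underline{\mathcal Q}_t^{i-1}(x)$ over $(x,y)\in\mathcal F_n$, $z\in\mathcal X_{t-1}$. For $t\le T-1$ choose $n\in\tilde{\mathcal N}(t)$ with the largest gap $\overline{\mathcal Q}_t^{i-1}(x_n^i)-\underline{\mathcal Q}_t^{i-1}(x_n^i)$ and set $x_t^i=x_n^i$. 2. *Backward step.* For $t=T,\dots,1$ and each $n\in\tilde{\mathcal N}(t)$ obtain an optimal primal-dual solution $(\hat x,\hat y,\hat z;\hat\lambda,\hat\rho)$ of $$\max_{(\lambda,\rho)\in\mathcal U_n}\ \min_{(x,y)\in\mathcal F_n,\,z\in\mathcal X_{t-1}}\ f_n(z,y,x)+\langle\lambda,x_{t-1}^i-z\rangle+\rho\psi_n(x_{t-1}^i-z)+\underline{\mathcal Q}_t^i(x),$$ with optimal value $\underline v_n^i$, and put $C_n^i(x)=\underline v_n^i-\langle\hat\lambda,x_{t-1}^i-x\rangle-\hat\rho\,\psi_n(x_{t-1}^i-x)$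 and $\overline v_n^i=f_n(z_n^i,y_n^i,x_n^i)+\sigma_n\psi_n(x_{t-1}^i-z_n^i)+\overline{\mathcal Q}_t^i(x_n^i)$. Then set $\underline{\mathcal Q}_{t-1}^i=\max\{\underline{\mathcal Q}_{t-1}^{i-1},\sum_{n\in\tilde{\mathcal N}(t)}p_nC_n^i\}$. With $h(x)=\sum_{n\in\tilde{\mathcal N}(t)}p_n(\overline v_n^i+\sigma_n\|x-x_{t-1}^i\|)$ and $g=\min\{\overline{\mathcal Q}_{t-1}^{i-1},h\}$ set $\overline{\mathcal Q}_{t-1}^i=g$ if the problem is not convex, and $\overline{\mathcal Q}_{t-1}^i(x)=g^{**}(x)=\sup_\lambda\inf_{z\in\mathbb R^{d_{t-1}}}\{g(z)+\langle\lambda,x-z\rangle\}$ if it is convex. 3. *Root update.* Obtain a minimizer $(x_0^{i+1},y_0^{i+1})$ of $f_r(y,x)+\underline{\mathcal Q}_0^i(x)$ over $\mathcal F_r$; set $\mathrm{LB}=f_r(y_0^{i+1},x_0^{i+1})+\underline{\mathcal Q}^i_0(x_0^{i+1})$ and replace $\mathrm{UB}$ by $\min\{\mathrm{UB},\ f_r(y_0^{i+1},x_0^{i+1})+\overline{\mathcal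 Q}^i_0(x_0^{i+1})\}$. The subproblem oracles may return any optimal solutions, and ties between gaps may be broken arbitrarily. **Theorem.** Let $\epsilon>0$ and let $\delta_0,\dots,\delta_{T-1}>0$ satisfy $\sum_{t=0}^{T-1}\delta_t=\epsilon$. For $0\le t\le T-1$ let $\mathcal B_{t,1},\dots,\mathcal B_{t,K_t}\subset\mathbb R^{d_t}$ be norm balls with diameters $D_{t,k}\ge0$ such that $\mathcal X_t\subseteq\bigcup_{k=1}^{K_t}\mathcal B_{t,k}$. If the algorithm stops (that is, its test $\mathrm{UB}-\mathrm{LB}\le\epsilon$ is met) at the end of iteration $i$, then $$i\le\sum_{t=0}^{T-1}\sum_{k=1}^{K_t}\Bigl(1+\frac{2L_tD_{t,k}}{\delta_t}\Bigr)^{d_t}.$$ The numbers $|\tilde{\mathcal N}(t)|$ of nodes do not occur in this bound; it depends on the nodes of stage $t+1$ only through the weighted mean $L_t$. -/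

import Mathlib

open Set Filter Topology Pointwise
open scoped ENNReal NNReal

universe u v w

/-- A nonnegative function `ψ` is a penalty function if it vanishes exactly at the origin and the
diameter of its level sets `{x | ψ x ≤ a}` tends to `0` as `a ↓ 0`. -/
structure IsPenaltyFunction {V : Type*} [NormedAddCommGroup V] (ψ : V → ℝ) : Prop where
  nonneg : ∀ x, 0 ≤ ψ x
  eq_zero_iff : ∀ x, ψ x = 0 ↔ x = 0
  tendsto_diam : Tendsto (fun a : ℝ => Metric.ediam {x | ψ x ≤ a}) (𝓝[>] 0) (𝓝 0)

/-- Convexity, on a convex set, of a function with values in `[0, +∞]`. -/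
def ConvexCostOn {V : Type*} [AddCommGroup V] [Module ℝ V] (s : Set V) (g : V → ℝ≥0∞) : Prop :=
  Convex ℝ s ∧ ∀ ⦃x⦄, x ∈ s → ∀ ⦃y⦄, y ∈ s → ∀ ⦃a b : ℝ⦄, 0 ≤ a → 0 ≤ b → a + b = 1 →
    g (a • x + b • y) ≤ ENNReal.ofReal a * g x + ENNReal.ofReal b * g y

/-- `conv {g, h} = (min {g, h})**`, by convex biconjugation over the whole space; the dual space
carries the slopes. -/
noncomputable def convMin {V : Type*} [NormedAddCommGroup V] [NormedSpace ℝ V]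
    (g h : V → EReal) (x : V) : EReal :=
  ⨆ lam : StrongDual ℝ V, ⨅ z : V, (min (g z) (h z) + ((lam (x - z) : ℝ) : EReal))

/-- The data of a stagewise independent multistage problem, written on its recombining scenario
tree, with stages `0, …, T`. All nodes of stage `t` have the same children, namely the elements of
`Node t`; so `Node t` is the set of (data-distinct) nodes of stage `t + 1`. Only the stages up to
`T` matter.

`State t` is the space (`ℝ` to some finite power, with an arbitrary norm) of the state variables
of stage `t`, and the internal variables of the root and of a node `n` lie in `Internal₀` and
`Internal n`. The root cost has no argument for the state of the dummy parent of the root. -/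
structure StagewiseProblem where
  /-- the last stage -/
  T : ℕ
  State : ℕ → Type u
  [stateNorm : ∀ t, NormedAddCommGroup (State t)]
  [stateSpaceReal : ∀ t, NormedSpace ℝ (State t)]
  [stateFinite : ∀ t, FiniteDimensional ℝ (State t)]
  /-- `Node t` consists of the nodes of stage `t + 1` -/
  Node : ℕ → Type v
  [nodeFintype : ∀ t, Fintype (Node t)]
  Internal₀ : Type w
  [internal₀Norm : NormedAddCommGroup Internal₀]
  [internal₀Real : NormedSpace ℝ Internal₀]
  [internal₀Finite : FiniteDimensional ℝ Internal₀]
  Internal : ∀ {t : ℕ}, Node t → Type w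
  [internalNorm : ∀ {t : ℕ} (n : Node t), NormedAddCommGroup (Internal n)]
  [internalReal : ∀ {t : ℕ} (n : Node t), NormedSpace ℝ (Internal n)]
  [internalFinite : ∀ {t : ℕ} (n : Node t), FiniteDimensional ℝ (Internal n)]
  /-- transition probability from any node of stage `t` to the node `n` of stage `t + 1` -/
  prob : ∀ {t : ℕ}, Node t → ℝ
  /-- feasible pairs `(x, y)` of the root -/
  feas₀ : Set (State 0 × Internal₀)
  /-- feasible pairs `(x, y)` of a node -/
  feas : ∀ {t : ℕ} (n : Node t), Set (State (t + 1) × Internal n)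
  /-- root cost `(y, x) ↦ f y x` -/
  cost₀ : Internal₀ → State 0 → ℝ≥0∞
  /-- nodal cost `(z, y, x) ↦ f z y x`, where `z` is (a copy of) the state of the parent -/
  cost : ∀ {t : ℕ} (n : Node t), State t → Internal n → State (t + 1) → ℝ≥0∞
  /-- penalty function of a node, on the state space of the parent -/
  pen : ∀ {t : ℕ}, Node t → State t → ℝ
  /-- penalty factor `σ` -/
  sigma : ∀ {t : ℕ}, Node t → ℝ
  /-- bound on the dual norm of the linear dual variable in the backward step -/
  boundLam : ∀ {t : ℕ}, Node t → ℝ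
  /-- bound on the penalty dual variable in the backward step -/
  boundRho : ∀ {t : ℕ}, Node t → ℝ

namespace StagewiseProblem

attribute [instance] stateNorm stateSpaceReal stateFinite nodeFintype internal₀Norm internal₀Real
  internal₀Finite internalNorm internalReal internalFinite

variable (P : StagewiseProblem.{u, v, w})

/-- The state space of stage `t`: the projection of the feasible sets to the state variable. (For
`0 < t < T` all nodes of the stage will be required to have the same projection.) -/
def stateSpace : (t : ℕ) → Set (P.State t)
  | 0 => Prod.fst '' P.feas₀
  | t + 1 => ⋃ n : P.Node t, Prod.fst '' P.feas n

/-- `HasFiniteCost k t x`: in the scenario tree below a node of stage `t` with state `x`, feasible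
decisions with finite costs can be chosen at all nodes of the next `k` stages. -/
def HasFiniteCost : (k t : ℕ) → P.State t → Prop
  | 0, _, _ => True
  | k + 1, t, x => ∀ n : P.Node t, ∃ q ∈ P.feas n,
      P.cost n x q.2 q.1 < ⊤ ∧ HasFiniteCost k (t + 1) q.1

/-- The problem (with penalization) is convex: feasible sets, costs and penalty functions are
convex. -/
structure IsConvexProblem : Prop where
  root : ConvexCostOn P.feas₀ (fun q => P.cost₀ q.2 q.1)
  feas : ∀ t < P.T, ∀ n : P.Node t, Convex ℝ (P.feas n)
  cost : ∀ t < P.T, ∀ n : P.Node t, ConvexCostOn (P.stateSpace t ×ˢ P.feas n)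
    (fun q : P.State t × P.State (t + 1) × P.Internal n => P.cost n q.1 q.2.2 q.2.1)
  pen : ∀ t < P.T, ∀ n : P.Node t, ConvexOn ℝ (P.stateSpace t - P.stateSpace t) (P.pen n)

/-- The standing assumptions on the problem and on the parameters of the algorithm. -/
structure IsAdmissible : Prop where
  prob_pos : ∀ t < P.T, ∀ n : P.Node t, 0 < P.prob n
  prob_sum : ∀ t < P.T, ∑ n : P.Node t, P.prob n = 1
  stateSpace_eq : ∀ t, t + 1 < P.T → ∀ n n' : P.Node t,
    Prod.fst '' P.feas n = Prod.fst '' P.feas n'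
  compact_root : IsCompact P.feas₀
  compact : ∀ t < P.T, ∀ n : P.Node t, IsCompact (P.feas n)
  lsc_root : LowerSemicontinuousOn (fun q : P.State 0 × P.Internal₀ => P.cost₀ q.2 q.1) P.feas₀
  lsc : ∀ t < P.T, ∀ n : P.Node t, LowerSemicontinuousOn
    (fun q : P.State t × P.State (t + 1) × P.Internal n => P.cost n q.1 q.2.2 q.2.1)
    (P.stateSpace t ×ˢ P.feas n)
  /-- some feasible point of the extensive form has finite total cost -/
  proper : ∃ q ∈ P.feas₀, P.cost₀ q.2 q.1 < ⊤ ∧ P.HasFiniteCost P.T 0 q.1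
  penalty : ∀ t < P.T, ∀ n : P.Node t, IsPenaltyFunction (P.pen n)
  penalty_lipschitz : ∀ t < P.T, ∀ n : P.Node t,
    LipschitzOnWith 1 (P.pen n) (P.stateSpace t - P.stateSpace t)
  sigma_pos : ∀ t < P.T, ∀ n : P.Node t, 0 < P.sigma n
  boundLam_nonneg : ∀ t < P.T, ∀ n : P.Node t, 0 ≤ P.boundLam n
  boundRho_nonneg : ∀ t < P.T, ∀ n : P.Node t, 0 ≤ P.boundRho n
  /-- Either the problem is convex, the penalties are norms, and linear cuts with slopes up to at
  least `σ` are used, or the penalty dual variable may be as large as `σ`. -/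
  bounds : (P.IsConvexProblem ∧ ∀ t < P.T, ∀ n : P.Node t,
      (∀ x, P.pen n x = ‖x‖) ∧ P.sigma n ≤ P.boundLam n ∧ P.boundRho n = 0) ∨
    (∀ t < P.T, ∀ n : P.Node t, P.sigma n ≤ P.boundRho n)

/-- `L_t`, the mean over the nodes `n` of stage `t + 1` of the sum of the two dual bounds. -/
noncomputable def lipConst (t : ℕ) : ℝ :=
  ∑ n : P.Node t, P.prob n * (P.boundLam n + P.boundRho n)

variable {P}

/-! Subproblems. A primal point of the subproblem of a node is a triple `(x, y, z)`; `xa` is the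
given state of the parent and `Θ` the given approximation of the cost-to-go function. -/

/-- `(x, y)` feasible for the node and `z` in the state space of the parent. -/
def nodalSet {t : ℕ} (n : P.Node t) : Set (P.State (t + 1) × P.Internal n × P.State t) :=
  {q | (q.1, q.2.1) ∈ P.feas n ∧ q.2.2 ∈ P.stateSpace t}

/-- The objective `f z y x + ⟨lam, xa - z⟩ + ρ ψ (xa - z) + Θ x`. -/
noncomputable def nodalObj {t : ℕ} (n : P.Node t) (xa : P.State t) (Θ : P.State (t + 1) → EReal)
    (lam : StrongDual ℝ (P.State t)) (ρ : ℝ)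
    (q : P.State (t + 1) × P.Internal n × P.State t) : EReal :=
  (P.cost n q.2.2 q.2.1 q.1 : EReal)
    + ((lam (xa - q.2.2) + ρ * P.pen n (xa - q.2.2) : ℝ) : EReal) + Θ q.1

/-- `q` is an output of the forward step oracle: an optimal solution `(x, y, z)` of
`min f z y x + σ ψ (xa - z) + Θ x`. -/
def IsForwardSol {t : ℕ} (n : P.Node t) (xa : P.State t) (Θ : P.State (t + 1) → EReal)
    (q : P.State (t + 1) × P.Internal n × P.State t) : Prop :=
  q ∈ nodalSet n ∧ IsMinOn (nodalObj n xa Θ 0 (P.sigma n)) (nodalSet n) q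

/-- The set of dual variables of the backward step. -/
def dualSet {t : ℕ} (n : P.Node t) : Set (StrongDual ℝ (P.State t) × ℝ) :=
  {u | ‖u.1‖ ≤ P.boundLam n ∧ 0 ≤ u.2 ∧ u.2 ≤ P.boundRho n}

/-- `(q, u)`, with `q = (x, y, z)` and `u = (lam, ρ)`, is an output of the backward step oracle: an
optimal primal-dual solution of `max_u min_q f z y x + ⟨lam, xa - z⟩ + ρ ψ (xa - z) + Θ x`. -/
def IsBackwardSol {t : ℕ} (n : P.Node t) (xa : P.State t) (Θ : P.State (t + 1) → EReal)
    (q : P.State (t + 1) × P.Internal n × P.State t) (u : StrongDual ℝ (P.State t) × ℝ) : Prop :=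
  q ∈ nodalSet n ∧ u ∈ dualSet n ∧ IsMinOn (nodalObj n xa Θ u.1 u.2) (nodalSet n) q ∧
    IsMaxOn (fun u' : StrongDual ℝ (P.State t) × ℝ =>
      ⨅ q' ∈ nodalSet n, nodalObj n xa Θ u'.1 u'.2 q') (dualSet n) u

/-- The objective of the root problem. -/
noncomputable def rootObj (Θ : P.State 0 → EReal) (q : P.State 0 × P.Internal₀) : EReal :=
  (P.cost₀ q.2 q.1 : EReal) + Θ q.1

/-- `q = (x, y)` is an output of the root oracle. -/
def IsRootSol (Θ : P.State 0 → EReal) (q : P.State 0 × P.Internal₀) : Prop :=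
  q ∈ P.feas₀ ∧ IsMinOn (rootObj Θ) P.feas₀ q

variable (P)

/-- The quantities that occur in an execution of the algorithm; the natural number is the iteration
index. -/
structure Trace where
  /-- `state i t` is the state `x_t^i` of stage `t` in iteration `i` -/
  state : ℕ → ∀ t, P.State t
  /-- `(state i 0, rootInternal i)` is the root solution in iteration `i` -/
  rootInternal : ℕ → P.Internal₀
  /-- forward solution `(x, y, z)` at a node -/
  fwd : ℕ → ∀ {t : ℕ} (n : P.Node t), P.State (t + 1) × P.Internal n × P.State t
  /-- primal part `(x, y, z)` of the backward solution at a node -/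
  bwd : ℕ → ∀ {t : ℕ} (n : P.Node t), P.State (t + 1) × P.Internal n × P.State t
  /-- dual part `(lam, ρ)` of the backward solution at a node -/
  dual : ℕ → ∀ {t : ℕ}, P.Node t → StrongDual ℝ (P.State t) × ℝ
  /-- under-approximations of the expected cost-to-go functions after iteration `i` -/
  underApp : ℕ → ∀ t, P.State t → EReal
  /-- over-approximations of the expected cost-to-go functions after iteration `i` -/
  overApp : ℕ → ∀ t, P.State t → EReal

namespace Trace

variable {P} (R : P.Trace)

/-- The value of the backward subproblem, the constant term of the cut. -/
noncomputable def underVal (i : ℕ) {t : ℕ} (n : P.Node t) : EReal :=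
  nodalObj n (R.state i t) (R.underApp i (t + 1)) (R.dual i n).1 (R.dual i n).2 (R.bwd i n)

/-- The generalized conjugacy cut
`x ↦ - ⟨lam, x_t^i - x⟩ - ρ ψ (x_t^i - x) + underVal` generated at node `n` in iteration `i`. -/
noncomputable def cut (i : ℕ) {t : ℕ} (n : P.Node t) (x : P.State t) : EReal :=
  ((-((R.dual i n).1 (R.state i t - x)) - (R.dual i n).2 * P.pen n (R.state i t - x) : ℝ) : EReal)
    + R.underVal i n

/-- `f z y x + σ ψ (x_t^i - z) + overApp i (t + 1) x` at the forward solution `(x, y, z)`. -/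
noncomputable def overVal (i : ℕ) {t : ℕ} (n : P.Node t) : EReal :=
  nodalObj n (R.state i t) (R.overApp i (t + 1)) 0 (P.sigma n) (R.fwd i n)

/-- The cone `x ↦ ∑ n, p n * (overVal n + σ n * ‖x - x_t^i‖)`. -/
noncomputable def cone (i t : ℕ) (x : P.State t) : EReal :=
  ∑ n : P.Node t,
    (P.prob n : EReal) * (R.overVal i n + ((P.sigma n * ‖x - R.state i t‖ : ℝ) : EReal))

open Classical in
/-- The over-approximation of stage `t` that iteration `i + 1` produces. -/
noncomputable def nextOver (i t : ℕ) : P.State t → EReal :=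
  if P.IsConvexProblem then convMin (R.overApp i t) (R.cone (i + 1) t)
  else fun x => min (R.overApp i t x) (R.cone (i + 1) t x)

/-- The approximation gap, in iteration `i + 1`, at the forward solution of node `n`. -/
noncomputable def gap (i : ℕ) {t : ℕ} (n : P.Node t) : EReal :=
  R.overApp i (t + 1) (R.fwd (i + 1) n).1 - R.underApp i (t + 1) (R.fwd (i + 1) n).1

/-- The lower bound after `i` iterations. -/
noncomputable def lowerBound (i : ℕ) : EReal :=
  rootObj (R.underApp i 0) (R.state (i + 1) 0, R.rootInternal (i + 1))

/-- The upper bound after `i` iterations. -/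
noncomputable def upperBound : ℕ → EReal
  | 0 => ⊤
  | i + 1 => min (upperBound i)
      (rootObj (R.overApp (i + 1) 0) (R.state (i + 2) 0, R.rootInternal (i + 2)))

/-- `R` records an execution of `k` iterations of the deterministic sampling dual dynamic
programming algorithm with tolerance `ε`. Below, `i < k`, and the iteration is number `i + 1`. -/
structure IsRun (ε : ℝ) (k : ℕ) : Prop where
  under_init : ∀ t ≤ P.T, ∀ x, R.underApp 0 t x = 0
  over_init : ∀ t < P.T, ∀ x, R.overApp 0 t x = ⊤
  under_leaf : ∀ i ≤ k, ∀ x, R.underApp i P.T x = 0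
  over_leaf : ∀ i ≤ k, ∀ x, R.overApp i P.T x = 0
  root : ∀ i ≤ k, IsRootSol (R.underApp i 0) (R.state (i + 1) 0, R.rootInternal (i + 1))
  /-- the while loop is entered again -/
  guard : ∀ i < k, (ε : EReal) < R.upperBound i - R.lowerBound i
  forward : ∀ i < k, ∀ t < P.T, ∀ n : P.Node t,
    IsForwardSol n (R.state (i + 1) t) (R.underApp i (t + 1)) (R.fwd (i + 1) n)
  /-- a node of stage `t + 1` with the largest gap determines the state of the stage -/
  select : ∀ i < k, ∀ t, t + 1 < P.T → ∃ n : P.Node t,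
    (∀ n' : P.Node t, R.gap i n' ≤ R.gap i n) ∧ R.state (i + 1) (t + 1) = (R.fwd (i + 1) n).1
  backward : ∀ i < k, ∀ t < P.T, ∀ n : P.Node t,
    IsBackwardSol n (R.state (i + 1) t) (R.underApp (i + 1) (t + 1)) (R.bwd (i + 1) n)
      (R.dual (i + 1) n)
  under_update : ∀ i < k, ∀ t < P.T, ∀ x, R.underApp (i + 1) t x =
    max (R.underApp i t x) (∑ n : P.Node t, (P.prob n : EReal) * R.cut (i + 1) n x)
  over_update : ∀ i < k, ∀ t < P.T, R.overApp (i + 1) t = R.nextOver i t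

/-- The algorithm stops at the end of iteration `k`. -/
def TerminatesAfter (ε : ℝ) (k : ℕ) : Prop :=
  R.IsRun ε k ∧ R.upperBound k - R.lowerBound k ≤ (ε : EReal)

end Trace

end StagewiseProblem

/-! Spread the tolerance over the stages by the tail sums Γ_t = δ_t + … + δ_{T-1}, so that Γ_0 = ε
and Γ_T = 0. While the loop runs, the gap between the over- and under-approximation at the root
state exceeds Γ_0. A child of largest gap is always selected, and the gap at stage T is zero, so
each iteration has a stage t whose gap at x_t exceeds Γ_t while all gaps at the forward solutions of
its children are at most Γ_{t+1} (`exists_stage`).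

Charge the iteration to that stage. Its update leaves a gap of at most Γ_{t+1} + 2 L_t ‖x - x_t‖ at
every x, permanently (`over_le_under_add`). A later iteration charged to t has a gap above Γ_t = δ_t
+ Γ_{t+1}, so its state is farther than δ_t / (2 L_t) from x_t. A volume comparison bounds the
number of such separated states in each covering ball (`card_le_of_separated_in_ball`).

The gap estimate rests on exact penalization: the dual bounds are large enough that the backward
value is at least the forward value (`forward_le_underVal`). Without convexity the dual point (0, σ)
reproduces the forward objective; with convexity Hahn–Banach turns the norm penalty into a linear
one (`Convex.exists_linear_penalty`). The true cost-to-go functions never enter. -/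

section Auxiliary

/-! ### Packing by volume, and separation by Hahn–Banach. -/

/-- Volume bound for the number of points of a ball with pairwise distances greater than `r`. -/
theorem card_le_of_separated_in_ball {V : Type*} [NormedAddCommGroup V] [NormedSpace ℝ V]
    [FiniteDimensional ℝ V] {ι : Type*} (s : Finset ι) (x : ι → V) (c : V) {D r : ℝ} (hD : 0 ≤ D)
    (hr : 0 < r) (hx : ∀ i ∈ s, x i ∈ Metric.closedBall c (D / 2))
    (hsep : ∀ i ∈ s, ∀ j ∈ s, i ≠ j → r < dist (x i) (x j)) :
    (s.card : ℝ) ≤ (1 + D / r) ^ Module.finrank ℝ V := by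
  borelize V
  let μ : MeasureTheory.Measure V := MeasureTheory.Measure.addHaar
  set d := Module.finrank ℝ V
  -- Disjoint balls of radius r/2 about the points fit into the ball of radius D/2 + r/2 about c;
  -- the ratio of the radii is 1 + D/r.
  have hdisj : (s : Set ι).PairwiseDisjoint fun i => Metric.ball (x i) (r / 2) := by
    intro i hi j hj hij
    exact Metric.ball_disjoint_ball (by linarith [hsep i hi j hj hij])
  have hsub : (⋃ i ∈ s, Metric.ball (x i) (r / 2)) ⊆ Metric.ball c (D / 2 + r / 2) := by
    refine iUnion₂_subset fun i hi => Metric.ball_subset_ball' ?_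
    have := Metric.mem_closedBall.1 (hx i hi)
    linarith
  have hmeas := MeasureTheory.measure_mono (μ := μ) hsub
  rw [MeasureTheory.measure_biUnion_finset hdisj (fun i _ => measurableSet_ball)] at hmeas
  have hpos : 0 < D / 2 + r / 2 := by positivity
  simp only [MeasureTheory.Measure.addHaar_ball_of_pos μ _ (half_pos hr),
    MeasureTheory.Measure.addHaar_ball_of_pos μ _ hpos, Finset.sum_const, nsmul_eq_mul,
    ← mul_assoc] at hmeas
  have h1 : (s.card : ℝ≥0∞) * ENNReal.ofReal ((r / 2) ^ d)
      ≤ ENNReal.ofReal ((D / 2 + r / 2) ^ d) := by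
    rwa [ENNReal.mul_le_mul_iff_left (Metric.measure_ball_pos μ 0 one_pos).ne'
      MeasureTheory.measure_ball_lt_top.ne] at hmeas
  rw [← ENNReal.ofReal_natCast, ← ENNReal.ofReal_mul (by positivity),
    ENNReal.ofReal_le_ofReal_iff (by positivity)] at h1
  have h2 : 1 + D / r = (D / 2 + r / 2) / (r / 2) := by field_simp; ring
  rw [h2, div_pow, le_div_iff₀ (by positivity)]
  exact h1

/-- A lower bound with a norm penalty on a convex set can be replaced by a linear one. -/
theorem Convex.exists_linear_penalty {V : Type*} [NormedAddCommGroup V] [NormedSpace ℝ V]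
    {A : Set (V × ℝ)} (hA : Convex ℝ A) (hne : A.Nonempty) {a : V} {s m : ℝ} (hs : 0 ≤ s)
    (h : ∀ p ∈ A, m ≤ p.2 + s * ‖a - p.1‖) :
    ∃ lam : StrongDual ℝ V, ‖lam‖ ≤ s ∧ ∀ p ∈ A, m ≤ p.2 + lam (a - p.1) := by
  -- The points strictly below the concave graph of m - s‖a - ·‖ are separated from A.
  let B : Set (V × ℝ) := {p | p.2 + s * ‖a - p.1‖ < m}
  have hBo : IsOpen B := isOpen_lt (by fun_prop) continuous_const
  have hBc : Convex ℝ B := by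
    intro p hp q hq α β hα hβ hαβ
    have hp' : p.2 + s * ‖a - p.1‖ < m := hp
    have hq' : q.2 + s * ‖a - q.1‖ < m := hq
    have e : a - (α • p.1 + β • q.1) = α • (a - p.1) + β • (a - q.1) := by
      calc a - (α • p.1 + β • q.1) = (α + β) • a - (α • p.1 + β • q.1) := by rw [hαβ, one_smul]
        _ = _ := by module
    have hn : ‖a - (α • p.1 + β • q.1)‖ ≤ α * ‖a - p.1‖ + β * ‖a - q.1‖ := by
      rw [e]
      refine (norm_add_le _ _).trans_eq ?_
      rw [norm_smul_of_nonneg hα, norm_smul_of_nonneg hβ]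
    change α * p.2 + β * q.2 + s * ‖a - (α • p.1 + β • q.1)‖ < m
    have hn' := mul_le_mul_of_nonneg_left hn hs
    have hlt : α * (p.2 + s * ‖a - p.1‖) + β * (q.2 + s * ‖a - q.1‖) < m := by
      rcases hα.eq_or_lt with rfl | hα'
      · obtain rfl : β = 1 := by linarith
        linarith
      · calc _ < α * m + β * m :=
              add_lt_add_of_lt_of_le (mul_lt_mul_of_pos_left hp' hα')
                (mul_le_mul_of_nonneg_left hq'.le hβ)
          _ = m := by rw [← add_mul, hαβ, one_mul]
    linarith
  have hdisj : Disjoint B A :=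
    Set.disjoint_left.2 fun p hp hpA => absurd (h p hpA) (not_le.2 hp)
  obtain ⟨f, u, hfB, hfA⟩ := geometric_hahn_banach_open hBc hBo hA hdisj
  set ℓ : StrongDual ℝ V := f.comp (ContinuousLinearMap.inl ℝ V ℝ)
  set τ : ℝ := f (0, 1)
  have hf : ∀ z r, f (z, r) = ℓ z + r * τ := by
    intro z r
    have : ((z, r) : V × ℝ) = (z, 0) + r • (0, 1) := by simp
    rw [this, map_add, map_smul]; rfl
  have hB : ∀ z r, r + s * ‖a - z‖ < m → ℓ z + r * τ < u := fun z r hr =>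
    hf z r ▸ hfB (z, r) hr
  have hA' : ∀ p ∈ A, u ≤ ℓ p.1 + p.2 * τ := fun p hp => hf p.1 p.2 ▸ hfA p hp
  obtain ⟨p₀, hp₀⟩ := hne
  have hτ : 0 < τ := by
    have h1 := hA' p₀ hp₀
    -- Lowering p₀ until its penalized value is m - 1 leads into B, so the separating hyperplane is
    -- not vertical.
    have h2 := hB p₀.1 (p₀.2 - (p₀.2 + s * ‖a - p₀.1‖ - m) - 1) (by linarith)
    have h3 := h p₀ hp₀
    by_contra hneg
    nlinarith
  have hB' : ∀ z, ℓ z + (m - s * ‖a - z‖) * τ ≤ u := by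
    intro z
    refine le_of_forall_pos_lt_add fun η hη => ?_
    have := hB z (m - s * ‖a - z‖ - η / τ) (by have := div_pos hη hτ; linarith)
    have e : η / τ * τ = η := by field_simp
    nlinarith
  have hle : ∀ w, ℓ w ≤ s * τ * ‖w‖ := by
    intro w
    by_contra! hw
    set g := ℓ w - s * τ * ‖w‖ with hg
    have hgp : 0 < g := by linarith
    -- Along the ray a + N w the left side of `hB'` would grow beyond u.
    obtain ⟨N, hN⟩ := exists_nat_gt ((u - ℓ a - m * τ) / g)
    rw [div_lt_iff₀ hgp] at hN
    have := hB' (a + (N : ℝ) • w)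
    rw [map_add, map_smul, sub_add_cancel_left, norm_neg, norm_smul, Real.norm_natCast,
      smul_eq_mul] at this
    nlinarith
  refine ⟨-(τ⁻¹ • ℓ), ?_, fun p hp => ?_⟩
  · refine ContinuousLinearMap.opNorm_le_bound _ hs fun w => ?_
    have h1 := hle w
    have h2 := hle (-w)
    rw [map_neg, norm_neg] at h2
    have h3 : |ℓ w| ≤ s * τ * ‖w‖ := abs_le.2 ⟨by linarith, h1⟩
    rw [_root_.neg_apply, norm_neg, _root_.smul_apply, norm_smul,
      Real.norm_eq_abs, Real.norm_eq_abs, abs_of_pos (inv_pos.2 hτ), inv_mul_le_iff₀ hτ]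
    linarith
  · have h1 := hB' a
    have h2 := hA' p hp
    simp only [sub_self, norm_zero, mul_zero, sub_zero] at h1
    have e : (-(τ⁻¹ • ℓ)) (a - p.1) = (ℓ p.1 - ℓ a) / τ := by
      simp [map_sub]; ring
    rw [e, ← sub_le_iff_le_add', le_div_iff₀ hτ]
    linarith

/-- Take z = x in the infimum. Of the biconjugate only this half, g** ≤ g, is needed. -/
theorem convMin_le {V : Type*} [NormedAddCommGroup V] [NormedSpace ℝ V] (g h : V → EReal) (x : V) :
    convMin g h x ≤ min (g x) (h x) := by
  refine iSup_le fun lam => (iInf_le _ x).trans_eq ?_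
  simp

theorem EReal.coe_finset_sum {ι : Type*} (s : Finset ι) (f : ι → ℝ) :
    ((∑ i ∈ s, f i : ℝ) : EReal) = ∑ i ∈ s, (f i : EReal) :=
  map_sum (⟨⟨Real.toEReal, EReal.coe_zero⟩, EReal.coe_add⟩ : ℝ →+ EReal) f s

end Auxiliary

namespace StagewiseProblem

/-! ### Consequences of the assumptions; finiteness and exact penalization of subproblems. -/

section Problem

variable {P : StagewiseProblem.{u, v, w}} (hP : P.IsAdmissible)
include hP

theorem IsAdmissible.nonempty_node {t : ℕ} (ht : t < P.T) : Nonempty (P.Node t) := by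
  by_contra h
  rw [not_nonempty_iff] at h
  simpa using hP.prob_sum t ht

/-- Follow a finite-cost solution down the tree through arbitrary children. This supplies the finite
competitor that keeps subproblem values below ⊤. -/
theorem IsAdmissible.exists_hasFiniteCost (t : ℕ) (ht : t ≤ P.T) :
    ∃ x ∈ P.stateSpace t, P.HasFiniteCost (P.T - t) t x := by
  induction t with
  | zero =>
    obtain ⟨q, hq, -, hfin⟩ := hP.proper
    exact ⟨q.1, ⟨q, hq, rfl⟩, by simpa using hfin⟩
  | succ t ih =>
    obtain ⟨x, -, hfin⟩ := ih (by omega)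
    obtain ⟨n⟩ := hP.nonempty_node (t := t) (by omega)
    have e : P.T - t = (P.T - (t + 1)) + 1 := by omega
    rw [e] at hfin
    obtain ⟨q, hq, -, hq'⟩ := hfin n
    exact ⟨q.1, mem_iUnion.2 ⟨n, q, hq, rfl⟩, hq'⟩

theorem IsAdmissible.exists_cost_lt_top {t : ℕ} (ht : t < P.T) (n : P.Node t) :
    ∃ z ∈ P.stateSpace t, ∃ q ∈ P.feas n, P.cost n z q.2 q.1 < ⊤ := by
  obtain ⟨x, hx, hfin⟩ := hP.exists_hasFiniteCost t ht.le
  have e : P.T - t = (P.T - (t + 1)) + 1 := by omega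
  rw [e] at hfin
  obtain ⟨q, hq, hc, -⟩ := hfin n
  exact ⟨x, hx, q, hq, hc⟩

theorem IsAdmissible.pen_le_norm {t : ℕ} (ht : t < P.T) (n : P.Node t) {x x' : P.State t}
    (hx : x ∈ P.stateSpace t) (hx' : x' ∈ P.stateSpace t) : P.pen n (x - x') ≤ ‖x - x'‖ := by
  have h := (hP.penalty_lipschitz t ht n).dist_le_mul _ (sub_mem_sub hx hx') _
    (sub_mem_sub hx hx)
  rw [sub_self, ((hP.penalty t ht n).eq_zero_iff 0).2 rfl, dist_zero_right, dist_zero_right,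
    Real.norm_eq_abs] at h
  simpa using (le_abs_self _).trans h

/-- Lets the single constant `lipConst` control the slopes of the cones as well as those of the
cuts. -/
theorem IsAdmissible.sigma_le {t : ℕ} (ht : t < P.T) (n : P.Node t) :
    P.sigma n ≤ P.boundLam n + P.boundRho n := by
  have h1 := hP.boundLam_nonneg t ht n
  have h2 := hP.boundRho_nonneg t ht n
  rcases hP.bounds with ⟨-, h⟩ | h
  · linarith [(h t ht n).2.1]
  · linarith [h t ht n]

theorem IsAdmissible.sum_sigma_le {t : ℕ} (ht : t < P.T) :
    ∑ n : P.Node t, P.prob n * P.sigma n ≤ P.lipConst t :=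
  Finset.sum_le_sum fun n _ =>
    mul_le_mul_of_nonneg_left (hP.sigma_le ht n) (hP.prob_pos t ht n).le

theorem IsAdmissible.lipConst_pos {t : ℕ} (ht : t < P.T) : 0 < P.lipConst t := by
  have := hP.nonempty_node ht
  refine lt_of_lt_of_le (Finset.sum_pos (fun n _ => ?_) Finset.univ_nonempty) (hP.sum_sigma_le ht)
  exact mul_pos (hP.prob_pos t ht n) (hP.sigma_pos t ht n)

omit hP in
theorem nodalObj_mono {t : ℕ} (n : P.Node t) (xa : P.State t) {Θ Θ' : P.State (t + 1) → EReal}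
    (lam : StrongDual ℝ (P.State t)) (ρ : ℝ) (q : P.State (t + 1) × P.Internal n × P.State t)
    (h : Θ q.1 ≤ Θ' q.1) : nodalObj n xa Θ lam ρ q ≤ nodalObj n xa Θ' lam ρ q :=
  add_le_add_right h _

omit hP in
-- The backward dual point is a maximizer, so any admissible dual point certifies a lower bound on
-- the value.
theorem IsBackwardSol.le_of_forall {t : ℕ} {n : P.Node t} {xa : P.State t}
    {Θ : P.State (t + 1) → EReal} {q : P.State (t + 1) × P.Internal n × P.State t}
    {u : StrongDual ℝ (P.State t) × ℝ} (h : IsBackwardSol n xa Θ q u)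
    {lam : StrongDual ℝ (P.State t)} {ρ : ℝ} (hu : (lam, ρ) ∈ dualSet n) {m : EReal}
    (hm : ∀ q' ∈ nodalSet n, m ≤ nodalObj n xa Θ lam ρ q') : m ≤ nodalObj n xa Θ u.1 u.2 q :=
  (le_iInf₂ hm).trans ((h.2.2.2 hu).trans (iInf₂_le q h.1))

omit hP in
theorem exists_real_cost {t : ℕ} {n : P.Node t} {xa : P.State t} {Θ : P.State (t + 1) → EReal}
    {lam : StrongDual ℝ (P.State t)} {ρ : ℝ} {q : P.State (t + 1) × P.Internal n × P.State t}
    {θ : ℝ} (hΘ : Θ q.1 = θ) (hlt : nodalObj n xa Θ lam ρ q < ⊤) :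
    ∃ c : ℝ, (P.cost n q.2.2 q.2.1 q.1 : EReal) = c ∧ 0 ≤ c := by
  have hc : P.cost n q.2.2 q.2.1 q.1 ≠ ⊤ := by
    intro hc
    rw [nodalObj, hΘ, hc, EReal.coe_ennreal_top, EReal.top_add_coe, EReal.top_add_coe] at hlt
    exact lt_irrefl _ hlt
  exact ⟨_, (EReal.coe_toReal (by simpa using hc) (by simp)).symm,
    EReal.toReal_nonneg (EReal.coe_ennreal_nonneg _)⟩

/-- The value of an optimal primal solution is finite if the approximation is. -/
theorem IsAdmissible.nodalObj_lt_top {t : ℕ} (ht : t < P.T) {n : P.Node t} {xa : P.State t}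
    {Θ : P.State (t + 1) → EReal} {θ : P.State (t + 1) → ℝ} (hΘ : ∀ x, Θ x = θ x)
    {lam : StrongDual ℝ (P.State t)} {ρ : ℝ} {q : P.State (t + 1) × P.Internal n × P.State t}
    (hq : IsMinOn (nodalObj n xa Θ lam ρ) (nodalSet n) q) : nodalObj n xa Θ lam ρ q < ⊤ := by
  obtain ⟨z, hz, q', hq', hc⟩ := hP.exists_cost_lt_top ht n
  refine (hq (show (q'.1, q'.2, z) ∈ nodalSet n from ⟨hq', hz⟩)).trans_lt ?_
  simp only [nodalObj, hΘ]
  refine EReal.add_lt_top (EReal.add_lt_top ?_ (EReal.coe_ne_top _)).ne (EReal.coe_ne_top _)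
  simpa using hc.ne

theorem IsAdmissible.exists_real_nodalObj {t : ℕ} (ht : t < P.T) {n : P.Node t} {xa : P.State t}
    {Θ : P.State (t + 1) → EReal} {θ : P.State (t + 1) → ℝ} (hΘ : ∀ x, Θ x = θ x)
    {lam : StrongDual ℝ (P.State t)} {ρ : ℝ} {q : P.State (t + 1) × P.Internal n × P.State t}
    (hq : IsMinOn (nodalObj n xa Θ lam ρ) (nodalSet n) q) :
    ∃ v : ℝ, nodalObj n xa Θ lam ρ q = v := by
  obtain ⟨c, hc, -⟩ := exists_real_cost (hΘ q.1) (hP.nodalObj_lt_top ht hΘ hq)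
  exact ⟨c + (lam (xa - q.2.2) + ρ * P.pen n (xa - q.2.2)) + θ q.1, by
    rw [nodalObj, hc, hΘ]; push_cast; rfl⟩

/-- Implicit in the convexity of the domain of the cost: project the product, whose second factor is
nonempty. -/
theorem IsConvexProblem.convex_stateSpace (hc : P.IsConvexProblem) {t : ℕ} (ht : t < P.T) :
    Convex ℝ (P.stateSpace t) := by
  obtain ⟨n⟩ := hP.nonempty_node ht
  obtain ⟨-, -, q', hq', -⟩ := hP.exists_cost_lt_top ht n
  have h := (hc.cost t ht n).1.linear_image (LinearMap.fst ℝ _ _)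
  have e : (LinearMap.fst ℝ (P.State t) (P.State (t + 1) × P.Internal n)) ''
      (P.stateSpace t ×ˢ P.feas n) = P.stateSpace t := fst_image_prod _ ⟨q', hq'⟩
  rwa [e] at h

/-- In the convex case the norm penalty of the forward problem can be replaced by a linear one. -/
theorem IsConvexProblem.exists_lam (hc : P.IsConvexProblem) {t : ℕ} (ht : t < P.T) (n : P.Node t)
    (hpen : ∀ x, P.pen n x = ‖x‖) {xa : P.State t}
    {Θ : P.State (t + 1) → EReal} {θ : P.State (t + 1) → ℝ} (hΘ : ∀ x, Θ x = θ x)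
    (hθ : ConvexOn ℝ univ θ) {q : P.State (t + 1) × P.Internal n × P.State t}
    (hq : IsForwardSol n xa Θ q) :
    ∃ lam : StrongDual ℝ (P.State t), ‖lam‖ ≤ P.sigma n ∧
      ∀ q' ∈ nodalSet n, nodalObj n xa Θ 0 (P.sigma n) q ≤ nodalObj n xa Θ lam 0 q' := by
  obtain ⟨m, hm⟩ := hP.exists_real_nodalObj ht hΘ hq.2
  -- Epigraph of the cost plus θ, with (x, y) projected out. The condition θ ≤ r is separate because
  -- `ENNReal.ofReal` truncates negative numbers to 0.
  let A : Set (P.State t × ℝ) := {p | ∃ q' ∈ P.feas n, p.1 ∈ P.stateSpace t ∧ θ q'.1 ≤ p.2 ∧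
    P.cost n p.1 q'.2 q'.1 ≤ ENNReal.ofReal (p.2 - θ q'.1)}
  have hA : Convex ℝ A := by
    rintro ⟨z₁, r₁⟩ ⟨q₁, hq₁, hz₁, hr₁, hc₁⟩ ⟨z₂, r₂⟩ ⟨q₂, hq₂, hz₂, hr₂, hc₂⟩ α β hα hβ hαβ
    have hθ' := hθ.2 (mem_univ q₁.1) (mem_univ q₂.1) hα hβ hαβ
    simp only [smul_eq_mul] at hθ' hr₁ hr₂ hc₁ hc₂
    refine ⟨α • q₁ + β • q₂, hc.feas t ht n hq₁ hq₂ hα hβ hαβ,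
      hc.convex_stateSpace hP ht hz₁ hz₂ hα hβ hαβ, ?_, ?_⟩
    · change θ (α • q₁.1 + β • q₂.1) ≤ α * r₁ + β * r₂
      nlinarith [mul_le_mul_of_nonneg_left hr₁ hα, mul_le_mul_of_nonneg_left hr₂ hβ]
    · have h := (hc.cost t ht n).2 (x := (z₁, q₁)) ⟨hz₁, hq₁⟩ (y := (z₂, q₂)) ⟨hz₂, hq₂⟩ hα hβ hαβ
      change P.cost n (α • z₁ + β • z₂) (α • q₁.2 + β • q₂.2) (α • q₁.1 + β • q₂.1) ≤
        ENNReal.ofReal (α * r₁ + β * r₂ - θ (α • q₁.1 + β • q₂.1))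
      refine (show P.cost n (α • z₁ + β • z₂) (α • q₁.2 + β • q₂.2) (α • q₁.1 + β • q₂.1) ≤
        _ from h).trans ?_
      calc _ ≤ ENNReal.ofReal α * ENNReal.ofReal (r₁ - θ q₁.1) +
            ENNReal.ofReal β * ENNReal.ofReal (r₂ - θ q₂.1) := by gcongr
        _ = ENNReal.ofReal (α * (r₁ - θ q₁.1) + β * (r₂ - θ q₂.1)) := by
            rw [← ENNReal.ofReal_mul hα, ← ENNReal.ofReal_mul hβ, ← ENNReal.ofReal_add
              (mul_nonneg hα (sub_nonneg.2 hr₁)) (mul_nonneg hβ (sub_nonneg.2 hr₂))]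
        _ ≤ _ := ENNReal.ofReal_le_ofReal (by linarith)
  have hmem : ∀ q' ∈ nodalSet n, ∀ c : ℝ, 0 ≤ c → (P.cost n q'.2.2 q'.2.1 q'.1 : EReal) = c →
      (q'.2.2, c + θ q'.1) ∈ A := by
    intro q' hq' c hc0 hcc
    refine ⟨(q'.1, q'.2.1), hq'.1, hq'.2, by simpa using hc0, ?_⟩
    rw [add_sub_cancel_right]
    rw [← EReal.coe_ennreal_le_coe_ennreal_iff, EReal.coe_ennreal_ofReal, max_eq_left hc0]
    exact hcc.le
  have hne : A.Nonempty := by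
    obtain ⟨c, hcc, hc0⟩ := exists_real_cost (hΘ q.1) (hP.nodalObj_lt_top ht hΘ hq.2)
    exact ⟨_, hmem q hq.1 c hc0 hcc⟩
  -- The penalized lower bound m on A is the optimality of q, as ψ is the norm.
  obtain ⟨lam, hlam, hle⟩ := hA.exists_linear_penalty hne (a := xa) (m := m)
    (hP.sigma_pos t ht n).le (by
      rintro ⟨z, r⟩ ⟨q', hq', hz, hr, hcr⟩
      have h := hq.2 (show (q'.1, q'.2, z) ∈ nodalSet n from ⟨hq', hz⟩)
      have h' : nodalObj n xa Θ 0 (P.sigma n) q ≤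
        nodalObj n xa Θ 0 (P.sigma n) (q'.1, q'.2, z) := h
      rw [hm] at h'
      simp only [nodalObj, hΘ, hpen] at h'
      rw [← EReal.coe_ennreal_le_coe_ennreal_iff, EReal.coe_ennreal_ofReal,
        max_eq_left (sub_nonneg.2 hr)] at hcr
      have h2 := h'.trans (add_le_add_left (add_le_add_left hcr _) _)
      rw [← EReal.coe_add, ← EReal.coe_add, EReal.coe_le_coe_iff] at h2
      simp only [_root_.zero_apply] at h2
      linarith)
  refine ⟨lam, hlam, fun q' hq' => ?_⟩
  rcases eq_or_ne (nodalObj n xa Θ lam 0 q') ⊤ with htop | htop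
  · rw [htop]; exact le_top
  obtain ⟨c, hcc, hc0⟩ := exists_real_cost (hΘ q'.1) htop.lt_top
  have h := hle _ (hmem q' hq' c hc0 hcc)
  rw [hm, nodalObj, hcc, hΘ, ← EReal.coe_add, ← EReal.coe_add, EReal.coe_le_coe_iff]
  linarith

end Problem

end StagewiseProblem

/-! ### Monotonicity and finiteness of the approximations along a run. -/

namespace StagewiseProblem.Trace

variable {P : StagewiseProblem.{u, v, w}} {R : P.Trace} {ε : ℝ} {k : ℕ}

theorem sum_cut {i t : ℕ} {v : P.Node t → ℝ} (hv : ∀ n, R.underVal i n = v n) (x : P.State t) :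
    ∑ n : P.Node t, (P.prob n : EReal) * R.cut i n x =
      ((∑ n : P.Node t, P.prob n * (-((R.dual i n).1 (R.state i t - x)) -
        (R.dual i n).2 * P.pen n (R.state i t - x) + v n) : ℝ) : EReal) := by
  rw [EReal.coe_finset_sum]
  refine Finset.sum_congr rfl fun n _ => ?_
  rw [cut, hv, ← EReal.coe_add, ← EReal.coe_mul]

theorem nextOver_le (i t : ℕ) (x : P.State t) :
    R.nextOver i t x ≤ min (R.overApp i t x) (R.cone (i + 1) t x) := by
  unfold nextOver
  split_ifs
  · exact convMin_le _ _ x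
  · exact le_rfl

namespace IsRun

variable (hR : R.IsRun ε k)
include hR

theorem over_anti {t : ℕ} (ht : t < P.T) (x : P.State t) {i j : ℕ} (hij : i ≤ j) (hj : j ≤ k) :
    R.overApp j t x ≤ R.overApp i t x := by
  induction j, hij using Nat.le_induction with
  | base => exact le_rfl
  | succ j hij ih =>
    rw [hR.over_update j (by omega) t ht]
    exact ((nextOver_le j t x).trans (min_le_left _ _)).trans (ih (by omega))

theorem under_mono {t : ℕ} (ht : t ≤ P.T) (x : P.State t) {i j : ℕ} (hij : i ≤ j) (hj : j ≤ k) :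
    R.underApp i t x ≤ R.underApp j t x := by
  rcases ht.eq_or_lt with rfl | ht
  · rw [hR.under_leaf i (by omega), hR.under_leaf j hj]
  induction j, hij using Nat.le_induction with
  | base => exact le_rfl
  | succ j hij ih =>
    rw [hR.under_update j (by omega) t ht]
    exact (ih (by omega)).trans (le_max_left _ _)

theorem over_succ_le (i t : ℕ) (hi : i < k) (ht : t ≤ P.T) (x : P.State t) :
    R.overApp (i + 1) t x ≤ R.overApp i t x := by
  rcases ht.eq_or_lt with rfl | ht
  · rw [hR.over_leaf i (by omega), hR.over_leaf (i + 1) hi]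
  · exact hR.over_anti ht x (by omega) (by omega)

theorem state_mem {i t : ℕ} (hi : i < k) (ht : t < P.T) :
    R.state (i + 1) t ∈ P.stateSpace t := by
  cases t with
  | zero => exact ⟨_, (hR.root i hi.le).1, rfl⟩
  | succ t =>
    obtain ⟨n, -, hn⟩ := hR.select i hi t ht
    rw [hn]
    exact mem_iUnion.2 ⟨n, _, (hR.forward i hi t (by omega) n).1.1, rfl⟩

variable (hP : P.IsAdmissible)
include hP

/-- The under-approximations are finite and, if the cuts are linear, convex. -/
theorem exists_real_under {i : ℕ} (hi : i ≤ k) {t : ℕ} (ht : t ≤ P.T) :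
    ∃ θ : P.State t → ℝ, (∀ x, R.underApp i t x = θ x) ∧
      ((∀ t < P.T, ∀ n : P.Node t, P.boundRho n = 0) → ConvexOn ℝ univ θ) := by
  induction i generalizing t with
  | zero =>
    exact ⟨fun _ => 0, fun x => by simp [hR.under_init t ht x],
      fun _ => convexOn_const 0 convex_univ⟩
  | succ i ih =>
    -- The backward sweep at stage t uses the already updated approximation of stage t + 1, hence an
    -- inner induction on s = T - t.
    obtain ⟨s, hs⟩ := Nat.exists_eq_add_of_le ht
    induction s generalizing t with
    | zero =>
      obtain rfl : t = P.T := by omega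
      exact ⟨fun _ => 0, fun x => by simp [hR.under_leaf (i + 1) hi x],
        fun _ => convexOn_const 0 convex_univ⟩
    | succ s ihs =>
      have ht' : t < P.T := by omega
      obtain ⟨θ₁, hθ₁, -⟩ := ihs (t := t + 1) (by omega) (by omega)
      obtain ⟨θ₀, hθ₀, hconv⟩ := ih (by omega) ht
      have hb := hR.backward i (by omega) t ht'
      have hv : ∀ n : P.Node t, ∃ v : ℝ, R.underVal (i + 1) n = v := fun n =>
        hP.exists_real_nodalObj ht' hθ₁ (hb n).2.2.1
      choose v hv using hv
      refine ⟨fun x => max (θ₀ x) (∑ n : P.Node t, P.prob n *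
        (-((R.dual (i + 1) n).1 (R.state (i + 1) t - x)) -
        (R.dual (i + 1) n).2 * P.pen n (R.state (i + 1) t - x) + v n)), fun x => ?_, fun hρ => ?_⟩
      · rw [hR.under_update i (by omega) t ht', hθ₀, sum_cut hv, EReal.coe_strictMono.monotone.map_max]
      -- With ρ = 0 the mean cut is affine, so its convexity inequality is an equality.
      · refine (hconv hρ).sup ⟨convex_univ, fun x _ y _ a b _ _ hab => le_of_eq ?_⟩
        simp only [smul_eq_mul, Finset.mul_sum, ← Finset.sum_add_distrib]
        refine Finset.sum_congr rfl fun n _ => ?_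
        have h0 : (R.dual (i + 1) n).2 = 0 :=
          le_antisymm ((hb n).2.1.2.2.trans_eq (hρ t ht' n)) (hb n).2.1.2.1
        simp only [h0, map_sub, map_add, map_smul, smul_eq_mul]
        linear_combination (P.prob n * ((R.dual (i + 1) n).1 (R.state (i + 1) t) - v n)) * hab

/-! ### Exact penalization and the gap estimate after an update. -/

/-- The backward value is at least the forward value. -/
theorem forward_le_underVal {i t : ℕ} (hi : i < k) (ht : t < P.T) (n : P.Node t) :
    nodalObj n (R.state (i + 1) t) (R.underApp i (t + 1)) 0 (P.sigma n) (R.fwd (i + 1) n) ≤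
      R.underVal (i + 1) n := by
  have hf := hR.forward i hi t ht n
  -- The forward problem uses the old approximation of stage t + 1, the backward problem the new
  -- one, which is no smaller.
  have hmono : ∀ lam ρ (q : P.State (t + 1) × P.Internal n × P.State t),
      nodalObj n (R.state (i + 1) t) (R.underApp i (t + 1)) lam ρ q ≤
      nodalObj n (R.state (i + 1) t) (R.underApp (i + 1) (t + 1)) lam ρ q := fun lam ρ q =>
    nodalObj_mono n _ lam ρ q (hR.under_mono ht q.1 (by omega) (by omega))
  rcases hP.bounds with ⟨hc, hb⟩ | hb
  · obtain ⟨θ, hθ, hconv⟩ := hR.exists_real_under hP hi.le (t := t + 1) ht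
    obtain ⟨lam, hlam, hle⟩ := hc.exists_lam hP ht n (hb t ht n).1 hθ
      (hconv fun t ht n => (hb t ht n).2.2) hf
    have hu : (lam, (0 : ℝ)) ∈ dualSet n :=
      ⟨hlam.trans (hb t ht n).2.1, le_rfl, hP.boundRho_nonneg t ht n⟩
    exact (hR.backward i hi t ht n).le_of_forall hu fun q hq => (hle q hq).trans (hmono _ _ q)
  · have hu : ((0 : StrongDual ℝ (P.State t)), P.sigma n) ∈ dualSet n :=
      ⟨by simpa using hP.boundLam_nonneg t ht n, (hP.sigma_pos t ht n).le, hb t ht n⟩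
    refine (hR.backward i hi t ht n).le_of_forall hu fun q hq => ?_
    have h : nodalObj n (R.state (i + 1) t) (R.underApp i (t + 1)) 0 (P.sigma n)
      (R.fwd (i + 1) n) ≤ nodalObj n (R.state (i + 1) t) (R.underApp i (t + 1)) 0 (P.sigma n) q :=
      hf.2 hq
    exact h.trans (hmono _ _ q)

/-- If the gap at the forward solutions of the children is at most `γ`, then from this iteration on
the gap of the stage is at most `γ` plus a multiple of the distance to the current state. -/
theorem over_le_under_add {i t : ℕ} (hi : i < k) (ht : t < P.T) {γ : ℝ}
    (hγ : ∀ n : P.Node t, R.gap i n ≤ γ) {j : ℕ} (hij : i < j) (hj : j ≤ k) {x : P.State t}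
    (hx : x ∈ P.stateSpace t) :
    R.overApp j t x ≤ R.underApp j t x +
      ((γ + 2 * P.lipConst t * ‖x - R.state (i + 1) t‖ : ℝ) : EReal) := by
  obtain ⟨θ, hθ, -⟩ := hR.exists_real_under hP hi.le (t := t + 1) ht
  obtain ⟨θ₁, hθ₁, -⟩ := hR.exists_real_under hP (i := i + 1) (by omega) (t := t + 1) ht
  set a := R.state (i + 1) t
  have ha : a ∈ P.stateSpace t := hR.state_mem hi ht
  have hb := hR.backward i hi t ht
  have hv : ∀ n : P.Node t, ∃ v : ℝ, R.underVal (i + 1) n = v := fun n =>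
    hP.exists_real_nodalObj ht hθ₁ (hb n).2.2.1
  choose v hv using hv
  -- At the forward solution, exchanging the under- for the over-approximation costs at most γ, and
  -- the forward value is at most v n.
  have hover : ∀ n : P.Node t, R.overVal (i + 1) n ≤ ((v n + γ : ℝ) : EReal) := by
    intro n
    have hf := hR.forward i hi t ht n
    obtain ⟨c, hc, -⟩ := exists_real_cost (hθ _) (hP.nodalObj_lt_top ht hθ hf.2)
    have h1 := hR.forward_le_underVal hP hi ht n
    rw [hv, nodalObj, hc, hθ, ← EReal.coe_add, ← EReal.coe_add, EReal.coe_le_coe_iff] at h1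
    have h2 : R.overApp (i + 1) (t + 1) (R.fwd (i + 1) n).1 ≤
        ((γ + θ (R.fwd (i + 1) n).1 : ℝ) : EReal) := by
      refine (hR.over_succ_le i (t + 1) hi ht _).trans ?_
      have h3 := hγ n
      rw [gap, hθ] at h3
      rw [EReal.coe_add]
      exact (EReal.sub_le_iff_le_add (Or.inl (EReal.coe_ne_bot _))
        (Or.inl (EReal.coe_ne_top _))).1 h3
    rw [overVal, nodalObj, hc]
    refine (add_le_add_right h2 _).trans ?_
    rw [← EReal.coe_add, ← EReal.coe_add, EReal.coe_le_coe_iff]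
    linarith
  have hcone : R.cone (i + 1) t x ≤
      ((∑ n : P.Node t, P.prob n * (v n + γ + P.sigma n * ‖x - a‖) : ℝ) : EReal) := by
    rw [EReal.coe_finset_sum]
    refine Finset.sum_le_sum fun n _ => ?_
    rw [EReal.coe_mul (P.prob n), EReal.coe_add (v n + γ)]
    exact mul_le_mul_of_nonneg_left (add_le_add_left (hover n) _)
      (EReal.coe_nonneg.2 (hP.prob_pos t ht n).le)
  have h1 : R.overApp j t x ≤
      ((∑ n : P.Node t, P.prob n * (v n + γ + P.sigma n * ‖x - a‖) : ℝ) : EReal) := by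
    refine ((hR.over_anti ht x (Nat.succ_le_of_lt hij) hj).trans ?_).trans hcone
    rw [hR.over_update i hi t ht]
    exact (nextOver_le i t x).trans (min_le_right _ _)
  -- Away from a each cut falls at most at rate l_λ + l_ρ; ψ ≤ ‖·‖ applies because a and x are both
  -- in the state space.
  have h2 : ((∑ n : P.Node t, P.prob n *
      (v n - (P.boundLam n + P.boundRho n) * ‖x - a‖) : ℝ) : EReal) ≤ R.underApp j t x := by
    refine le_trans ?_ (hR.under_mono ht.le x (Nat.succ_le_of_lt hij) hj)
    rw [hR.under_update i hi t ht, sum_cut hv]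
    refine le_trans (EReal.coe_le_coe_iff.2 (Finset.sum_le_sum fun n _ => ?_)) (le_max_right _ _)
    refine mul_le_mul_of_nonneg_left ?_ (hP.prob_pos t ht n).le
    obtain ⟨-, ⟨hl, hr0, hr⟩, -⟩ := hb n
    have e1 : (R.dual (i + 1) n).1 (a - x) ≤ P.boundLam n * ‖x - a‖ := by
      rw [norm_sub_rev]
      exact (le_abs_self _).trans ((R.dual (i + 1) n).1.le_of_opNorm_le hl _)
    have e2 : (R.dual (i + 1) n).2 * P.pen n (a - x) ≤ P.boundRho n * ‖x - a‖ := by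
      rw [norm_sub_rev]
      exact (mul_le_mul_of_nonneg_left (hP.pen_le_norm ht n ha hx) hr0).trans
        (mul_le_mul_of_nonneg_right hr (norm_nonneg _))
    change _ ≤ -((R.dual (i + 1) n).1 (a - x)) - (R.dual (i + 1) n).2 * P.pen n (a - x) + v n
    linarith
  refine h1.trans (le_trans ?_ (add_le_add_left h2 _))
  rw [← EReal.coe_add, EReal.coe_le_coe_iff]
  have e1 : ∑ n : P.Node t, P.prob n * (v n + γ + P.sigma n * ‖x - a‖) =
      ∑ n : P.Node t, P.prob n * v n + γ + (∑ n : P.Node t, P.prob n * P.sigma n) * ‖x - a‖ := by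
    simp only [mul_add, Finset.sum_add_distrib, ← Finset.sum_mul, hP.prob_sum t ht, one_mul,
      ← mul_assoc]
  have e2 : ∑ n : P.Node t, P.prob n * (v n - (P.boundLam n + P.boundRho n) * ‖x - a‖) =
      ∑ n : P.Node t, P.prob n * v n - P.lipConst t * ‖x - a‖ := by
    simp only [mul_sub, Finset.sum_sub_distrib, ← Finset.sum_mul, ← mul_assoc, lipConst]
  -- The factor 2 arises here: the cone rises at most at rate L_t and the mean cut falls at most at
  -- rate L_t.
  have e3 := mul_le_mul_of_nonneg_right (hP.sum_sigma_le ht) (norm_nonneg (x - a))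
  rw [e1, e2]
  linarith

/-! ### Large gaps while the loop runs. -/

/-- The loop condition forces a large gap at the root state. -/
theorem root_gap {i : ℕ} (hi : i < k) (hT : 0 < P.T) :
    R.underApp i 0 (R.state (i + 1) 0) + (ε : EReal) < R.overApp i 0 (R.state (i + 1) 0) := by
  obtain ⟨θ, hθ, -⟩ := hR.exists_real_under hP hi.le (t := 0) hT.le
  by_contra! hle
  rw [hθ, ← EReal.coe_add] at hle
  cases i with
  | zero =>
    rw [hR.over_init 0 hT] at hle
    exact EReal.coe_ne_top _ (top_le_iff.1 hle)
  | succ i =>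
    obtain ⟨hq, hmin⟩ := hR.root (i + 1) hi.le
    -- A finite competitor makes the root cost at the solution finite. It then cancels in UB - LB,
    -- as both bounds are evaluated at this same root point.
    obtain ⟨q, hqf, hqc, -⟩ := hP.proper
    have hlt : rootObj (R.underApp (i + 1) 0)
        (R.state (i + 2) 0, R.rootInternal (i + 2)) < ⊤ := by
      refine (hmin hqf).trans_lt ?_
      simp only [rootObj, hθ]
      exact EReal.add_lt_top (by simpa using hqc.ne) (EReal.coe_ne_top _)
    have hc : P.cost₀ (R.rootInternal (i + 2)) (R.state (i + 2) 0) ≠ ⊤ := by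
      intro hc
      rw [rootObj, hθ, hc, EReal.coe_ennreal_top, EReal.top_add_coe] at hlt
      exact lt_irrefl _ hlt
    obtain ⟨c, hc⟩ : ∃ c : ℝ,
        (P.cost₀ (R.rootInternal (i + 2)) (R.state (i + 2) 0) : EReal) = c :=
      ⟨_, (EReal.coe_toReal (by simpa using hc) (by simp)).symm⟩
    have hg := hR.guard (i + 1) hi
    have hU : R.upperBound (i + 1) ≤ ((c + (θ (R.state (i + 2) 0) + ε) : ℝ) : EReal) := by
      refine (min_le_right _ _).trans ?_
      rw [rootObj, hc, EReal.coe_add]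
      exact add_le_add_right hle _
    have hL : R.lowerBound (i + 1) = ((c + θ (R.state (i + 2) 0) : ℝ) : EReal) := by
      rw [lowerBound, rootObj, hc, hθ, EReal.coe_add]
    have h := hg.trans_le (EReal.sub_le_sub hU hL.ge)
    rw [← EReal.coe_sub, EReal.coe_lt_coe_iff] at h
    linarith

/-- In each iteration there is a stage with a large gap, all whose children have small gaps. -/
theorem exists_stage {i : ℕ} (hi : i < k) (hT : 0 < P.T) {Γ : ℕ → ℝ} (h0 : Γ 0 = ε)
    (hΓ : Γ P.T = 0) :
    ∃ t < P.T, R.underApp i t (R.state (i + 1) t) + (Γ t : EReal) <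
      R.overApp i t (R.state (i + 1) t) ∧ ∀ n : P.Node t, R.gap i n ≤ Γ (t + 1) := by
  by_contra! hno
  have key : ∀ t < P.T, R.underApp i t (R.state (i + 1) t) + (Γ t : EReal) <
      R.overApp i t (R.state (i + 1) t) := by
    intro t ht
    induction t with
    | zero => rw [h0]; exact hR.root_gap hP hi hT
    | succ t ih =>
      obtain ⟨n, hn⟩ := hno t (by omega) (ih (by omega))
      obtain ⟨n', hn', hs⟩ := hR.select i hi t ht
      have h := hn.trans_le (hn' n)
      rw [gap, ← hs] at h
      rw [add_comm]
      exact EReal.add_lt_of_lt_sub h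
  -- No selection takes place at stage T; there both approximations vanish, so a gap above Γ T = 0
  -- is absurd.
  obtain ⟨s, hs⟩ : ∃ s, P.T = s + 1 := ⟨P.T - 1, by omega⟩
  obtain ⟨n, hn⟩ := hno s (by omega) (key s (by omega))
  have e1 : ∀ x, R.overApp i (s + 1) x = 0 := hs ▸ hR.over_leaf i hi.le
  have e2 : ∀ x, R.underApp i (s + 1) x = 0 := hs ▸ hR.under_leaf i hi.le
  rw [gap, e1, e2, ← hs, hΓ] at hn
  simp at hn

end IsRun

end StagewiseProblem.Trace

/-! ### Counting the iterations charged to each stage. -/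

theorem mainTheorem1 (P : StagewiseProblem.{u, v, w}) (hP : P.IsAdmissible)
    (ε : ℝ) (hε : 0 < ε)
    (δ : ℕ → ℝ) (hδ : ∀ t < P.T, 0 < δ t) (hsum : ∑ t ∈ Finset.range P.T, δ t = ε)
    (K : ℕ → ℕ) (c : ∀ t, Fin (K t) → P.State t) (D : ∀ t, Fin (K t) → ℝ)
    (hD : ∀ t < P.T, ∀ k, 0 ≤ D t k)
    (hcover : ∀ t < P.T, P.stateSpace t ⊆ ⋃ k, Metric.closedBall (c t k) (D t k / 2))
    (R : P.Trace) (i : ℕ) (hR : R.TerminatesAfter ε i) :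
    (i : ℝ) ≤ ∑ t ∈ Finset.range P.T, ∑ k : Fin (K t),
      (1 + 2 * P.lipConst t * D t k / δ t) ^ Module.finrank ℝ (P.State t) := by
  classical
  obtain ⟨hR, -⟩ := hR
  have hT : 0 < P.T := by
    by_contra h
    rw [Nat.eq_zero_of_not_pos h] at hsum
    simp at hsum
    linarith
  let Γ : ℕ → ℝ := fun t => ∑ s ∈ Finset.Ico t P.T, δ s
  have hΓ : ∀ t < P.T, Γ t = δ t + Γ (t + 1) := fun t ht => Finset.sum_eq_sum_Ico_succ_bot ht _
  have hstage : ∀ j, ∃ t, j < i → t < P.T ∧ R.underApp j t (R.state (j + 1) t) + (Γ t : EReal) <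
      R.overApp j t (R.state (j + 1) t) ∧ ∀ n : P.Node t, R.gap j n ≤ Γ (t + 1) := by
    intro j
    by_cases hj : j < i
    · obtain ⟨t, h⟩ := hR.exists_stage hP hj hT (Γ := Γ)
        (by simpa [Γ, ← Finset.range_eq_Ico] using hsum) (by simp [Γ])
      exact ⟨t, fun _ => h⟩
    · exact ⟨0, fun h => absurd h hj⟩
  choose τ hτ using hstage
  -- The update made by iteration j + 1 is in force in iteration j' + 1, where the gap still exceeds
  -- Γ t = δ t + Γ (t + 1); the distance term must make up δ t.
  have hsep : ∀ t j j', j < j' → j' < i → τ j = t → τ j' = t →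
      δ t / (2 * P.lipConst t) < dist (R.state (j + 1) t) (R.state (j' + 1) t) := by
    rintro t j j' hjj hj' rfl e
    obtain ⟨ht, -, hgap⟩ := hτ j (hjj.trans hj')
    have h1 := (hτ j' hj').2.1
    rw [e] at h1
    have h2 := hR.over_le_under_add hP (hjj.trans hj') ht hgap hjj hj'.le (hR.state_mem hj' ht)
    have h3 := h1.trans_le h2
    obtain ⟨θ, hθ, -⟩ := hR.exists_real_under hP hj'.le ht.le
    rw [hθ, ← EReal.coe_add, ← EReal.coe_add, EReal.coe_lt_coe_iff, hΓ _ ht] at h3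
    rw [div_lt_iff₀ (by have := hP.lipConst_pos ht; positivity), dist_comm, dist_eq_norm]
    linarith
  -- The fibres of τ partition the iterations by stage.
  have hcard : i = ∑ t ∈ Finset.range P.T, ((Finset.range i).filter (τ · = t)).card := by
    rw [← Finset.card_eq_sum_card_fiberwise, Finset.card_range]
    exact fun j hj => by simpa using (hτ j (by simpa using hj)).1
  rw [hcard, Nat.cast_sum]
  refine Finset.sum_le_sum fun t ht => ?_
  rw [Finset.mem_range] at ht
  have hL := hP.lipConst_pos ht
  have hr : 0 < δ t / (2 * P.lipConst t) := div_pos (hδ t ht) (by positivity)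
  have hsub : (Finset.range i).filter (τ · = t) ⊆ Finset.univ.biUnion fun k : Fin (K t) =>
      ((Finset.range i).filter (τ · = t)).filter
        fun j => R.state (j + 1) t ∈ Metric.closedBall (c t k) (D t k / 2) := by
    intro j hj
    have hj' := Finset.mem_filter.1 hj
    obtain ⟨k, hk⟩ := mem_iUnion.1 (hcover t ht
      (hR.state_mem (Finset.mem_range.1 hj'.1) ht))
    exact Finset.mem_biUnion.2 ⟨k, Finset.mem_univ k, Finset.mem_filter.2 ⟨hj, hk⟩⟩
  refine (Nat.cast_le.2 ((Finset.card_le_card hsub).trans Finset.card_biUnion_le)).trans ?_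
  rw [Nat.cast_sum]
  refine Finset.sum_le_sum fun k _ => ?_
  have e : 2 * P.lipConst t * D t k / δ t = D t k / (δ t / (2 * P.lipConst t)) := by
    rw [div_div_eq_mul_div]; ring
  rw [e]
  refine card_le_of_separated_in_ball _ (fun j => R.state (j + 1) t) (c t k) (hD t ht k) hr
    (fun j hj => (Finset.mem_filter.1 hj).2) fun j hj j' hj' hne => ?_
  simp only [Finset.mem_filter, Finset.mem_range] at hj hj'
  rcases hne.lt_or_gt with h | h
  · exact hsep t j j' h hj'.1.1 hj.1.2 hj'.1.2
  · rw [dist_comm]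
    exact hsep t j' j h hj.1.1 hj'.1.2 hj.1.2
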